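/- **Setting.** Fix a set $\mathsf{AtSen}$ of atomic sentences, a set $\mathsf{Agents}$ of agents, and an action signature $\Sigma$: a finite set of action types with a binary relation $\to_A$ for each agent $A$ and an enumeration $\sigma_1,\dots,\sigma_n$ of its elements without repetitions. The sentences $\varphi$ and programs $\pi$ of $L_0(\Sigma)$ are given by $$\varphi ::= \mathsf{true}\mid p\mid \neg\varphi\mid \varphi\wedge\psi\mid \Box_A\varphi\mid [\pi]\varphi,\qquad \pi ::= \mathit{skip}\mid \mathit{crash}\mid \sigma_i\psi_1\cdots\psi_n\mid \pi\cup\rho\mid \pi\circ\rho ,$$ with $p\in\mathsf{AtSen}$, $A\in\mathsf{Agents}$, $1\le i\le n$; $\mathsf{false}$, $\to$ and $\leftrightarrow$ are the usual abbreviations. **Semantics.** A state model $S$ is a multi-agent Kripke model. An epistemic proposition assigns to each state model a set of its states. A program model $P$ consists of a set of simple actions with relations $\to_A$, an epistemic proposition $\mathrm{pre}(\sigma)$ for each simple action $\sigma$, and a set $\Gamma$ of designated simple actions. The update product $S\otimes P$ has as states the pairs $(s,\sigma)$ with $s\in \mathrm{pre}(\sigma)_S$; its arrows are the product arrows, and $(s,\sigma)$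 satisfies $p$ iff $s$ does. Each sentence $\varphi$ denotes an epistemic proposition $[\![\varphi]\!]$ and each program a program model $[\![\pi]\!]$: Boolean connectives and $\Box_A$ are interpreted as usual, and $s\in[\![[\pi]\varphi]\!]_S$ iff $(s,\sigma)\in[\![\varphi]\!]_{S\otimes[\![\pi]\!]}$ for every designated $\sigma$ of $[\![\pi]\!]$ with $s\in\mathrm{pre}(\sigma)_S$. Here $[\![\mathit{skip}]\!]$ has a single action, designated, always executable and reflexive for all agents; $[\![\mathit{crash}]\!]$ is empty; $[\![\sigma_i\vec\psi]\!]$ is $\Sigma$ with $\mathrm{pre}(\sigma_j)=[\![\psi_j]\!]$ and $\Gamma=\{\sigma_i\}$; $\cup$ is disjoint union; and $[\![\pi\circ\rho]\!]$ is the product of $[\![\pi]\!]$ and $[\![\rho]\!]$ with product arrows and designated set, where $s\in\mathrm{pre}(\sigma,\delta)_S$ iff $s\in \mathrm{pre}(\sigma)_S$ and $(s,\sigma)\in\mathrm{pre}(\delta)_{S\otimes[\![\pi]\!]}$. **Proof system.** $\vdash\varphi$ means that $\varphi$ is derivable from the following axioms, for all sentences and programs of $L_0(\Sigma)$: all sentential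 validities; $[\pi](\varphi\to\psi)\to([\pi]\varphi\to[\pi]\psi)$; $\Box_A(\varphi\to\psi)\to(\Box_A\varphi\to\Box_A\psi)$; $[\sigma_i\vec\psi]p\leftrightarrow(\psi_i\to p)$; $[\sigma_i\vec\psi]\neg\chi\leftrightarrow(\psi_i\to\neg[\sigma_i\vec\psi]\chi)$; $[\sigma_i\vec\psi]\Box_A\varphi\leftrightarrow\bigl(\psi_i\to\bigwedge\{\Box_A[\sigma_j\vec\psi]\varphi:\sigma_i\to_A\sigma_j\}\bigr)$; $[\mathit{skip}]\varphi\leftrightarrow\varphi$; $[\mathit{crash}]\mathsf{false}$; $[\pi][\rho]\varphi\leftrightarrow[\pi\circ\rho]\varphi$; $[\pi\cup\rho]\varphi\leftrightarrow[\pi]\varphi\wedge[\rho]\varphi$; by modus ponens and the rules: from $\vdash\psi$ infer $\vdash[\pi]\psi$; from $\vdash\varphi$ infer $\vdash\Box_A\varphi$. For a set $T$ of sentences, $T\vdash\varphi$ means that $\vdash(\chi_1\wedge\dots\wedge\chi_k)\to\varphi$ for some finitely many $\chi_1,\dots,\chi_k\in T$ ($k\ge 0$), and $T\models\varphi$ means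 that for every state model $S$ and every state $s$ of $S$, if $s\in[\![\chi]\!]_S$ for all $\chi\in T$, then $s\in[\![\varphi]\!]_S$. **Theorem (strong completeness for $L_0(\Sigma)$).** For every set $T$ of sentences of $L_0(\Sigma)$ and every sentence $\varphi$ of $L_0(\Sigma)$, $$T\vdash\varphi\iff T\models\varphi.$$ -/

import Mathlib

universe u

namespace EpistemicActions

/-! ### State models, epistemic propositions, updates -/

/-- A multi-agent Kripke model (the set of states may be empty). -/
structure StateModel (AtSen Agents : Type u) : Type (u + 1) where
  State : Type u
  arrow : Agents → State → State → Prop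
  val : AtSen → Set State

/-- An epistemic proposition assigns to every state model a set of its states. -/
def EpistemicProposition (AtSen Agents : Type u) : Type (u + 1) :=
  (S : StateModel AtSen Agents) → Set S.State

namespace EpistemicProposition

variable {AtSen Agents : Type u}

/-- The always true proposition. -/
def tr : EpistemicProposition AtSen Agents := fun _ => Set.univ

/-- The atomic proposition of an atomic sentence. -/
def atom (p : AtSen) : EpistemicProposition AtSen Agents := fun S => S.val p

def neg (φ : EpistemicProposition AtSen Agents) : EpistemicProposition AtSen Agents :=
  fun S => (φ S)ᶜ

def and (φ ψ : EpistemicProposition AtSen Agents) : EpistemicProposition AtSen Agents :=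
  fun S => φ S ∩ ψ S

def box (A : Agents) (φ : EpistemicProposition AtSen Agents) :
    EpistemicProposition AtSen Agents :=
  fun S => {s | ∀ t, S.arrow A s t → t ∈ φ S}

end EpistemicProposition

/-- An update: an update map on state models together with, for each state model `S`, an update
relation from the states of `S` to those of its image. -/
structure Update (AtSen Agents : Type u) : Type (u + 1) where
  map : StateModel AtSen Agents → StateModel AtSen Agents
  rel : (S : StateModel AtSen Agents) → S.State → (map S).State → Prop

namespace Update

variable {AtSen Agents : Type u}

/-- The dynamic modality `[a]φ`. -/
def box (a : Update AtSen Agents) (φ : EpistemicProposition AtSen Agents) :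
    EpistemicProposition AtSen Agents :=
  fun S => {s | ∀ t, a.rel S s t → t ∈ φ (a.map S)}

/-- The dual dynamic modality `⟨a⟩φ`. -/
def dia (a : Update AtSen Agents) (φ : EpistemicProposition AtSen Agents) :
    EpistemicProposition AtSen Agents :=
  fun S => {s | ∃ t, a.rel S s t ∧ t ∈ φ (a.map S)}

end Update

/-! ### Action models, program models and the update product -/

/-- An epistemic action model. -/
structure ActionModel (AtSen Agents : Type u) : Type (u + 1) where
  Action : Type u
  arrow : Agents → Action → Action → Prop
  pre : Action → EpistemicProposition AtSen Agents

/-- A program model: an action model with a set of designated simple actions. -/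
structure ProgramModel (AtSen Agents : Type u) : Type (u + 1)
    extends ActionModel AtSen Agents where
  designated : Set Action

/-- The update product `S ⊗ Σ`. -/
def updateProduct {AtSen Agents : Type u} (S : StateModel AtSen Agents)
    (M : ActionModel AtSen Agents) : StateModel AtSen Agents where
  State := {x : S.State × M.Action // x.1 ∈ M.pre x.2 S}
  arrow A x y := S.arrow A x.1.1 y.1.1 ∧ M.arrow A x.1.2 y.1.2
  val p := {x | x.1.1 ∈ S.val p}

/-- The update `(Σ, Γ)` induced by an action model and a set of its simple actions. -/
def ActionModel.inducedUpdate {AtSen Agents : Type u} (M : ActionModel AtSen Agents)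
    (Γ : Set M.Action) : Update AtSen Agents where
  map S := updateProduct S M
  rel _ s t := t.1.1 = s ∧ t.1.2 ∈ Γ

namespace ProgramModel

variable {AtSen Agents : Type u}

/-- The update induced by a program model. -/
def update (P : ProgramModel AtSen Agents) : Update AtSen Agents :=
  P.toActionModel.inducedUpdate P.designated

/-- One action, always executable, reflexive for every agent, designated. -/
def skip : ProgramModel AtSen Agents where
  Action := PUnit
  arrow _ _ _ := True
  pre _ := EpistemicProposition.tr
  designated := Set.univ

/-- The empty program model. -/
def crash : ProgramModel AtSen Agents where
  Action := PEmpty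
  arrow _ _ _ := False
  pre a := a.elim
  designated := ∅

/-- Sequential composition (first `P`, then `Q`). -/
def comp (P Q : ProgramModel AtSen Agents) : ProgramModel AtSen Agents where
  Action := P.Action × Q.Action
  arrow A x y := P.arrow A x.1 y.1 ∧ Q.arrow A x.2 y.2
  pre x := (P.toActionModel.inducedUpdate {x.1}).dia (Q.pre x.2)
  designated := P.designated ×ˢ Q.designated

/-- Disjoint union (non-deterministic choice). -/
def union (P Q : ProgramModel AtSen Agents) : ProgramModel AtSen Agents where
  Action := P.Action ⊕ Q.Action
  arrow A := Sum.LiftRel (P.arrow A) (Q.arrow A)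
  pre := Sum.elim P.pre Q.pre
  designated := Sum.inl '' P.designated ∪ Sum.inr '' Q.designated

end ProgramModel

/-! ### Action signatures -/

/-- An action signature: a finite Kripke frame with an enumeration `σ₁, …, σₙ` of its elements
(the action types) without repetitions. -/
structure ActionSignature (Agents : Type u) : Type (u + 1) where
  ActionType : Type u
  arrow : Agents → ActionType → ActionType → Prop
  n : ℕ
  enum : Fin n ≃ ActionType

/-- The signature-based program model `(Σ, Γ, ψ₁, …, ψₙ)`. -/
def ActionSignature.programModel {AtSen Agents : Type u} (Sig : ActionSignature Agents)
    (Γ : Set Sig.ActionType) (ψ : Fin Sig.n → EpistemicProposition AtSen Agents) :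
    ProgramModel AtSen Agents where
  Action := Sig.ActionType
  arrow := Sig.arrow
  pre σ := ψ (Sig.enum.symm σ)
  designated := Γ

/-! ### The language `L₀(Σ)`: no common knowledge and no program iteration -/

mutual

/-- Sentences of `L₀(Σ)`. -/
inductive Sentence (AtSen Agents : Type u) (Sig : ActionSignature Agents) : Type u
  | tr : Sentence AtSen Agents Sig
  | atom (p : AtSen) : Sentence AtSen Agents Sig
  | neg (φ : Sentence AtSen Agents Sig) : Sentence AtSen Agents Sig
  | and (φ ψ : Sentence AtSen Agents Sig) : Sentence AtSen Agents Sig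
  | box (A : Agents) (φ : Sentence AtSen Agents Sig) : Sentence AtSen Agents Sig
  | after (π : Program AtSen Agents Sig) (φ : Sentence AtSen Agents Sig) :
      Sentence AtSen Agents Sig

/-- Programs of `L₀(Σ)`; `basic i ψ` is the basic action `σᵢ ψ₁ ⋯ ψₙ`. -/
inductive Program (AtSen Agents : Type u) (Sig : ActionSignature Agents) : Type u
  | skip : Program AtSen Agents Sig
  | crash : Program AtSen Agents Sig
  | basic (i : Fin Sig.n) (ψ : Fin Sig.n → Sentence AtSen Agents Sig) :
      Program AtSen Agents Sig
  | union (π ρ : Program AtSen Agents Sig) : Program AtSen Agents Sig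
  | comp (π ρ : Program AtSen Agents Sig) : Program AtSen Agents Sig

end

mutual

/-- The epistemic proposition `⟦φ⟧` denoted by a sentence. -/
def Sentence.sem {AtSen Agents : Type u} {Sig : ActionSignature Agents} :
    Sentence AtSen Agents Sig → EpistemicProposition AtSen Agents
  | .tr => EpistemicProposition.tr
  | .atom p => EpistemicProposition.atom p
  | .neg φ => φ.sem.neg
  | .and φ ψ => φ.sem.and ψ.sem
  | .box A φ => EpistemicProposition.box A φ.sem
  | .after π φ => π.sem.update.box φ.sem

/-- The program model `⟦π⟧` denoted by a program. -/
def Program.sem {AtSen Agents : Type u} {Sig : ActionSignature Agents} :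
    Program AtSen Agents Sig → ProgramModel AtSen Agents
  | .skip => ProgramModel.skip
  | .crash => ProgramModel.crash
  | .basic i ψ => Sig.programModel {Sig.enum i} (fun j => (ψ j).sem)
  | .union π ρ => π.sem.union ρ.sem
  | .comp π ρ => π.sem.comp ρ.sem

end

namespace Sentence

variable {AtSen Agents : Type u} {Sig : ActionSignature Agents}

/-! ### Abbreviations -/

def fls : Sentence AtSen Agents Sig := tr.neg

def imp (φ ψ : Sentence AtSen Agents Sig) : Sentence AtSen Agents Sig := (φ.and ψ.neg).neg

def iff (φ ψ : Sentence AtSen Agents Sig) : Sentence AtSen Agents Sig :=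
  (φ.imp ψ).and (ψ.imp φ)

/-- The conjunction of a finite list of sentences; the empty conjunction is `true`. -/
def conj : List (Sentence AtSen Agents Sig) → Sentence AtSen Agents Sig
  | [] => tr
  | φ :: L => φ.and (conj L)

open Classical in
/-- The conjunction of all `□_A [σⱼ ψ₁ ⋯ ψₙ] φ` with `σᵢ →_A σⱼ` in the signature. -/
noncomputable def actionKnowledgeConj (i : Fin Sig.n) (ψ : Fin Sig.n → Sentence AtSen Agents Sig)
    (A : Agents) (φ : Sentence AtSen Agents Sig) : Sentence AtSen Agents Sig :=
  conj (((List.finRange Sig.n).filter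
    (fun j => decide (Sig.arrow A (Sig.enum i) (Sig.enum j)))).map
      (fun j => box A (after (.basic j ψ) φ)))

/-- A sentential validity: true under every assignment of truth values to all sentences that
respects the connectives `true`, `¬`, `∧` (equivalently, a substitution instance of a
propositional tautology). -/
def IsSententialValidity (φ : Sentence AtSen Agents Sig) : Prop :=
  ∀ v : Sentence AtSen Agents Sig → Prop,
    v tr → (∀ χ, v (neg χ) ↔ ¬ v χ) → (∀ χ θ, v (and χ θ) ↔ v χ ∧ v θ) → v φ

end Sentence

/-! ### The proof system for `L₀(Σ)` -/

open Sentence in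
/-- `⊢ φ` in the logical system for `L₀(Σ)`. -/
inductive Provable {AtSen Agents : Type u} {Sig : ActionSignature Agents} :
    Sentence AtSen Agents Sig → Prop
  | sentential (φ : Sentence AtSen Agents Sig) : IsSententialValidity φ → Provable φ
  | after_normality (π : Program AtSen Agents Sig) (φ ψ : Sentence AtSen Agents Sig) :
      Provable ((after π (φ.imp ψ)).imp ((after π φ).imp (after π ψ)))
  | box_normality (A : Agents) (φ ψ : Sentence AtSen Agents Sig) :
      Provable ((box A (φ.imp ψ)).imp ((box A φ).imp (box A ψ)))
  | atomic_permanence (i : Fin Sig.n) (ψ : Fin Sig.n → Sentence AtSen Agents Sig) (p : AtSen) :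
      Provable ((after (.basic i ψ) (atom p)).iff ((ψ i).imp (atom p)))
  | partial_functionality (i : Fin Sig.n) (ψ : Fin Sig.n → Sentence AtSen Agents Sig)
      (χ : Sentence AtSen Agents Sig) :
      Provable ((after (.basic i ψ) χ.neg).iff ((ψ i).imp (after (.basic i ψ) χ).neg))
  | action_knowledge (i : Fin Sig.n) (ψ : Fin Sig.n → Sentence AtSen Agents Sig) (A : Agents)
      (φ : Sentence AtSen Agents Sig) :
      Provable ((after (.basic i ψ) (box A φ)).iff ((ψ i).imp (actionKnowledgeConj i ψ A φ)))
  | skip_axiom (φ : Sentence AtSen Agents Sig) : Provable ((after .skip φ).iff φ)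
  | crash_axiom : Provable (after .crash fls)
  | composition (π ρ : Program AtSen Agents Sig) (φ : Sentence AtSen Agents Sig) :
      Provable ((after π (after ρ φ)).iff (after (.comp π ρ) φ))
  | choice (π ρ : Program AtSen Agents Sig) (φ : Sentence AtSen Agents Sig) :
      Provable ((after (.union π ρ) φ).iff ((after π φ).and (after ρ φ)))
  | modus_ponens (φ ψ : Sentence AtSen Agents Sig) :
      Provable φ → Provable (φ.imp ψ) → Provable ψ
  | after_necessitation (π : Program AtSen Agents Sig) (ψ : Sentence AtSen Agents Sig) :
      Provable ψ → Provable (after π ψ)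
  | box_necessitation (A : Agents) (φ : Sentence AtSen Agents Sig) :
      Provable φ → Provable (box A φ)

/-- `T ⊢ φ`: for some finitely many `χ₁, …, χₖ ∈ T`, the sentence `χ₁ ∧ ⋯ ∧ χₖ → φ` is provable.
(Necessitation is thus applied to theorems only.) -/
def ProvableFrom {AtSen Agents : Type u} {Sig : ActionSignature Agents}
    (T : Set (Sentence AtSen Agents Sig)) (φ : Sentence AtSen Agents Sig) : Prop :=
  ∃ L : List (Sentence AtSen Agents Sig), (∀ χ ∈ L, χ ∈ T) ∧ Provable ((Sentence.conj L).imp φ)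

/-- `T ⊨ φ`: in every state model, `φ` holds at every state at which all sentences of `T` hold. -/
def Entails {AtSen Agents : Type u} {Sig : ActionSignature Agents}
    (T : Set (Sentence AtSen Agents Sig)) (φ : Sentence AtSen Agents Sig) : Prop :=
  ∀ (S : StateModel AtSen Agents) (s : S.State), (∀ χ ∈ T, s ∈ χ.sem S) → s ∈ φ.sem S

end EpistemicActions

namespace EpistemicActions

/-! ### Bisimulations and invariance -/

section Bisimulation

variable {AtSen Agents : Type u}

/-- `R` is a bisimulation between the state models `S` and `S'`. -/
structure IsBisimulation (S S' : StateModel AtSen Agents) (R : S.State → S'.State → Prop) :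
    Prop where
  val : ∀ {s s'}, R s s' → ∀ p, s ∈ S.val p ↔ s' ∈ S'.val p
  forth : ∀ {s s'}, R s s' → ∀ A t, S.arrow A s t → ∃ t', S'.arrow A s' t' ∧ R t t'
  back : ∀ {s s'}, R s s' → ∀ A t', S'.arrow A s' t' → ∃ t, S.arrow A s t ∧ R t t'

/-- An epistemic proposition is invariant if it cannot separate bisimilar states. -/
def EpistemicProposition.IsInvariant (φ : EpistemicProposition AtSen Agents) : Prop :=
  ∀ (S S' : StateModel AtSen Agents) (R : S.State → S'.State → Prop), IsBisimulation S S' R →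
    ∀ s s', R s s' → (s ∈ φ S ↔ s' ∈ φ S')

theorem IsBisimulation.symm {S S' : StateModel AtSen Agents} {R : S.State → S'.State → Prop}
    (h : IsBisimulation S S' R) : IsBisimulation S' S (fun s' s => R s s') where
  val hR p := (h.val hR p).symm
  forth hR := h.back hR
  back hR := h.forth hR

theorem IsBisimulation.updateProduct {S S' : StateModel AtSen Agents}
    {R : S.State → S'.State → Prop} (h : IsBisimulation S S' R) {M : ActionModel AtSen Agents}
    (hM : ∀ a, (M.pre a).IsInvariant) :
    IsBisimulation (updateProduct S M) (updateProduct S' M)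
      (fun x x' => R x.1.1 x'.1.1 ∧ x.1.2 = x'.1.2) where
  val hR p := h.val hR.1 p
  forth := by
    rintro ⟨⟨s, a⟩, hs⟩ ⟨⟨s', a'⟩, hs'⟩ ⟨hR, rfl⟩ A ⟨⟨t, b⟩, ht⟩ ⟨hst, hab⟩
    obtain ⟨t', hst', hR'⟩ := h.forth hR A t hst
    exact ⟨⟨(t', b), (hM b _ _ _ h _ _ hR').1 ht⟩, ⟨hst', hab⟩, hR', rfl⟩
  back := by
    rintro ⟨⟨s, a⟩, hs⟩ ⟨⟨s', a'⟩, hs'⟩ ⟨hR, rfl⟩ A ⟨⟨t', b⟩, ht'⟩ ⟨hst, hab⟩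
    obtain ⟨t, hst', hR'⟩ := h.back hR A t' hst
    exact ⟨⟨(t, b), (hM b _ _ _ h _ _ hR').2 ht'⟩, ⟨hst', hab⟩, hR', rfl⟩

namespace EpistemicProposition.IsInvariant

variable {φ ψ : EpistemicProposition AtSen Agents}

theorem neg (hφ : φ.IsInvariant) : φ.neg.IsInvariant :=
  fun S S' R h s s' hR => not_congr (hφ S S' R h s s' hR)

theorem and (hφ : φ.IsInvariant) (hψ : ψ.IsInvariant) : (φ.and ψ).IsInvariant :=
  fun S S' R h s s' hR => and_congr (hφ S S' R h s s' hR) (hψ S S' R h s s' hR)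

theorem box (A : Agents) (hφ : φ.IsInvariant) : (EpistemicProposition.box A φ).IsInvariant := by
  intro S S' R h s s' hR
  constructor
  · intro hs t' ht'
    obtain ⟨t, ht, hR'⟩ := h.back hR A t' ht'
    exact (hφ _ _ _ h _ _ hR').1 (hs t ht)
  · intro hs t ht
    obtain ⟨t', ht', hR'⟩ := h.forth hR A t ht
    exact (hφ _ _ _ h _ _ hR').2 (hs t' ht')

theorem update_dia {M : ActionModel AtSen Agents} (hM : ∀ a, (M.pre a).IsInvariant)
    (Γ : Set M.Action) (hφ : φ.IsInvariant) : ((M.inducedUpdate Γ).dia φ).IsInvariant := by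
  have key : ∀ (S S' : StateModel AtSen Agents) (R : S.State → S'.State → Prop),
      IsBisimulation S S' R → ∀ s s', R s s' →
        s ∈ (M.inducedUpdate Γ).dia φ S → s' ∈ (M.inducedUpdate Γ).dia φ S' := by
    rintro S S' R h s s' hR ⟨⟨⟨_, a⟩, hs⟩, ⟨rfl, ha⟩, hmem⟩
    exact ⟨⟨(s', a), (hM a _ _ _ h _ _ hR).1 hs⟩, ⟨rfl, ha⟩,
      (hφ _ _ _ (h.updateProduct hM) _ _ ⟨hR, rfl⟩).1 hmem⟩
  exact fun S S' R h s s' hR => ⟨key S S' R h s s' hR, key S' S _ h.symm s' s hR⟩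

theorem update_box {M : ActionModel AtSen Agents} (hM : ∀ a, (M.pre a).IsInvariant)
    (Γ : Set M.Action) (hφ : φ.IsInvariant) : ((M.inducedUpdate Γ).box φ).IsInvariant := by
  have key : ∀ (S S' : StateModel AtSen Agents) (R : S.State → S'.State → Prop),
      IsBisimulation S S' R → ∀ s s', R s s' →
        s ∈ (M.inducedUpdate Γ).box φ S → s' ∈ (M.inducedUpdate Γ).box φ S' := by
    rintro S S' R h s s' hR hbox ⟨⟨_, a⟩, hs⟩ ⟨rfl, ha⟩
    exact (hφ _ _ _ (h.updateProduct hM) _ _ ⟨hR, rfl⟩).1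
      (hbox ⟨(s, a), (hM a _ _ _ h _ _ hR).2 hs⟩ ⟨rfl, ha⟩)
  exact fun S S' R h s s' hR => ⟨key S S' R h s s' hR, key S' S _ h.symm s' s hR⟩

end EpistemicProposition.IsInvariant

variable {Sig : ActionSignature Agents}

mutual

theorem Sentence.sem_isInvariant : (φ : Sentence AtSen Agents Sig) → φ.sem.IsInvariant
  | .tr => fun _ _ _ _ _ _ _ => Iff.rfl
  | .atom p => fun _ _ _ h _ _ hR => h.val hR p
  | .neg φ => (Sentence.sem_isInvariant φ).neg
  | .and φ ψ => (Sentence.sem_isInvariant φ).and (Sentence.sem_isInvariant ψ)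
  | .box A φ => (Sentence.sem_isInvariant φ).box A
  | .after π φ => .update_box (Program.pre_isInvariant π) _ (Sentence.sem_isInvariant φ)

theorem Program.pre_isInvariant :
    (π : Program AtSen Agents Sig) → ∀ a, (π.sem.pre a).IsInvariant
  | .skip => fun _ _ _ _ _ _ _ _ => Iff.rfl
  | .crash => fun a => a.elim
  | .basic _ ψ => fun a => Sentence.sem_isInvariant (ψ (Sig.enum.symm a))
  | .union π ρ => fun a => match a with
    | .inl a => Program.pre_isInvariant π a
    | .inr a => Program.pre_isInvariant ρ a
  | .comp π ρ => fun a =>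
    .update_dia (Program.pre_isInvariant π) _ (Program.pre_isInvariant ρ a.2)

end

end Bisimulation

/-! ### Soundness -/

section Soundness

variable {AtSen Agents : Type u} {Sig : ActionSignature Agents}

namespace ProgramModel

theorem mem_update_box_iff {P : ProgramModel AtSen Agents}
    {φ : EpistemicProposition AtSen Agents} {S : StateModel AtSen Agents} {s : S.State} :
    s ∈ P.update.box φ S ↔
      ∀ a, a ∈ P.designated → ∀ h : s ∈ P.pre a S,
        (⟨(s, a), h⟩ : (updateProduct S P.toActionModel).State) ∈
          φ (updateProduct S P.toActionModel) := by
  constructor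
  · intro hs a ha h
    exact hs ⟨(s, a), h⟩ ⟨rfl, ha⟩
  · rintro hs ⟨⟨_, a⟩, h⟩ ⟨rfl, ha⟩
    exact hs a ha h

theorem skip_isBisimulation (S : StateModel AtSen Agents) :
    IsBisimulation (updateProduct S (skip : ProgramModel AtSen Agents).toActionModel) S
      (fun x s => x.1.1 = s) where
  val := by rintro x _ rfl p; exact Iff.rfl
  forth := by rintro x _ rfl A y hy; exact ⟨_, hy.1, rfl⟩
  back := by rintro x _ rfl A t ht; exact ⟨⟨(t, PUnit.unit), trivial⟩, ⟨ht, trivial⟩, rfl⟩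

theorem union_isBisimulation_inl (S : StateModel AtSen Agents)
    (P Q : ProgramModel AtSen Agents) :
    IsBisimulation (updateProduct S P.toActionModel) (updateProduct S (P.union Q).toActionModel)
      (fun x y => x.1.1 = y.1.1 ∧ y.1.2 = Sum.inl x.1.2) where
  val := by
    rintro ⟨⟨s, a⟩, hs⟩ ⟨⟨_, _⟩, hs'⟩ ⟨rfl, rfl⟩ p
    exact Iff.rfl
  forth := by
    rintro ⟨⟨s, a⟩, hs⟩ ⟨⟨_, _⟩, hs'⟩ ⟨rfl, rfl⟩ A ⟨⟨t, b⟩, ht⟩ ⟨hst, hab⟩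
    exact ⟨⟨(t, Sum.inl b), ht⟩, ⟨hst, Sum.LiftRel.inl hab⟩, rfl, rfl⟩
  back := by
    rintro ⟨⟨s, a⟩, hs⟩ ⟨⟨_, _⟩, hs'⟩ ⟨rfl, rfl⟩ A ⟨⟨t, b⟩, ht⟩ ⟨hst, hab⟩
    rcases hab with ⟨hab⟩
    exact ⟨⟨(t, _), ht⟩, ⟨hst, hab⟩, rfl, rfl⟩

theorem union_isBisimulation_inr (S : StateModel AtSen Agents)
    (P Q : ProgramModel AtSen Agents) :
    IsBisimulation (updateProduct S Q.toActionModel) (updateProduct S (P.union Q).toActionModel)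
      (fun x y => x.1.1 = y.1.1 ∧ y.1.2 = Sum.inr x.1.2) where
  val := by
    rintro ⟨⟨s, a⟩, hs⟩ ⟨⟨_, _⟩, hs'⟩ ⟨rfl, rfl⟩ p
    exact Iff.rfl
  forth := by
    rintro ⟨⟨s, a⟩, hs⟩ ⟨⟨_, _⟩, hs'⟩ ⟨rfl, rfl⟩ A ⟨⟨t, b⟩, ht⟩ ⟨hst, hab⟩
    exact ⟨⟨(t, Sum.inr b), ht⟩, ⟨hst, Sum.LiftRel.inr hab⟩, rfl, rfl⟩
  back := by
    rintro ⟨⟨s, a⟩, hs⟩ ⟨⟨_, _⟩, hs'⟩ ⟨rfl, rfl⟩ A ⟨⟨t, b⟩, ht⟩ ⟨hst, hab⟩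
    rcases hab with _ | ⟨hab⟩
    exact ⟨⟨(t, _), ht⟩, ⟨hst, hab⟩, rfl, rfl⟩

theorem mem_comp_pre_iff {P Q : ProgramModel AtSen Agents} {S : StateModel AtSen Agents}
    {s : S.State} {a : P.Action} {b : Q.Action} :
    s ∈ (P.comp Q).pre (a, b) S ↔ ∃ h : s ∈ P.pre a S,
      (⟨(s, a), h⟩ : (updateProduct S P.toActionModel).State) ∈
        Q.pre b (updateProduct S P.toActionModel) := by
  constructor
  · rintro ⟨⟨⟨_, _⟩, hs⟩, ⟨rfl, rfl⟩, hb⟩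
    exact ⟨hs, hb⟩
  · rintro ⟨hs, hb⟩
    exact ⟨⟨(s, a), hs⟩, ⟨rfl, rfl⟩, hb⟩

theorem comp_isBisimulation (S : StateModel AtSen Agents) (P Q : ProgramModel AtSen Agents) :
    IsBisimulation (updateProduct (updateProduct S P.toActionModel) Q.toActionModel)
      (updateProduct S (P.comp Q).toActionModel)
      (fun x y => x.1.1.1.1 = y.1.1 ∧ y.1.2 = (x.1.1.1.2, x.1.2)) where
  val := by
    rintro ⟨⟨⟨⟨s, a⟩, hs⟩, b⟩, hb⟩ ⟨⟨_, _⟩, hs'⟩ ⟨rfl, rfl⟩ p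
    exact Iff.rfl
  forth := by
    rintro ⟨⟨⟨⟨s, a⟩, hs⟩, b⟩, hb⟩ ⟨⟨_, _⟩, hs'⟩ ⟨rfl, rfl⟩ A
      ⟨⟨⟨⟨t, c⟩, ht⟩, d⟩, hd⟩ ⟨⟨hst, hac⟩, hbd⟩
    exact ⟨⟨(t, (c, d)), mem_comp_pre_iff.2 ⟨ht, hd⟩⟩, ⟨hst, hac, hbd⟩, rfl, rfl⟩
  back := by
    rintro ⟨⟨⟨⟨s, a⟩, hs⟩, b⟩, hb⟩ ⟨⟨_, _⟩, hs'⟩ ⟨rfl, rfl⟩ A ⟨⟨t, c, d⟩, h⟩ ⟨hst, hac, hbd⟩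
    obtain ⟨ht, hd⟩ := mem_comp_pre_iff.1 h
    exact ⟨⟨(⟨(t, c), ht⟩, d), hd⟩, ⟨⟨hst, hac⟩, hbd⟩, rfl, rfl⟩

variable {φ : EpistemicProposition AtSen Agents} {S : StateModel AtSen Agents} {s : S.State}

theorem mem_skip_box_iff (hφ : φ.IsInvariant) : s ∈ skip.update.box φ S ↔ s ∈ φ S := by
  rw [mem_update_box_iff]
  constructor
  · intro h
    exact (hφ _ _ _ (skip_isBisimulation S) _ _ rfl).1 (h PUnit.unit trivial trivial)
  · intro h a _ ha
    exact (hφ _ _ _ (skip_isBisimulation S) _ _ rfl).2 h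

theorem mem_union_box_iff (hφ : φ.IsInvariant) (P Q : ProgramModel AtSen Agents) :
    s ∈ (P.union Q).update.box φ S ↔ s ∈ P.update.box φ S ∧ s ∈ Q.update.box φ S := by
  simp only [mem_update_box_iff]
  constructor
  · intro h
    exact ⟨fun a ha hs => (hφ _ _ _ (union_isBisimulation_inl S P Q) _ _ ⟨rfl, rfl⟩).2
        (h (Sum.inl a) (Or.inl ⟨a, ha, rfl⟩) hs),
      fun a ha hs => (hφ _ _ _ (union_isBisimulation_inr S P Q) _ _ ⟨rfl, rfl⟩).2
        (h (Sum.inr a) (Or.inr ⟨a, ha, rfl⟩) hs)⟩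
  · rintro ⟨h₁, h₂⟩ _ (⟨a, ha, rfl⟩ | ⟨a, ha, rfl⟩) hs
    · exact (hφ _ _ _ (union_isBisimulation_inl S P Q) _ _ ⟨rfl, rfl⟩).1 (h₁ a ha hs)
    · exact (hφ _ _ _ (union_isBisimulation_inr S P Q) _ _ ⟨rfl, rfl⟩).1 (h₂ a ha hs)

theorem mem_comp_box_iff (hφ : φ.IsInvariant) (P Q : ProgramModel AtSen Agents) :
    s ∈ (P.comp Q).update.box φ S ↔ s ∈ P.update.box (Q.update.box φ) S := by
  rw [mem_update_box_iff, mem_update_box_iff]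
  constructor
  · intro h a ha hs
    refine mem_update_box_iff.2 fun b hb hsb => ?_
    exact (hφ _ _ _ (comp_isBisimulation S P Q) _ _ ⟨rfl, rfl⟩).2
      (h (a, b) ⟨ha, hb⟩ (mem_comp_pre_iff.2 ⟨hs, hsb⟩))
  · rintro h ⟨a, b⟩ ⟨ha, hb⟩ hs
    obtain ⟨hsa, hsb⟩ := mem_comp_pre_iff.1 hs
    exact (hφ _ _ _ (comp_isBisimulation S P Q) ⟨(⟨(s, a), hsa⟩, b), hsb⟩ ⟨(s, a, b), hs⟩
      ⟨rfl, rfl⟩).1 (mem_update_box_iff.1 (h a ha hsa) b hb hsb)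

end ProgramModel

namespace Sentence

variable {S : StateModel AtSen Agents} {s : S.State} {φ ψ : Sentence AtSen Agents Sig}

theorem mem_sem_imp : s ∈ (φ.imp ψ).sem S ↔ (s ∈ φ.sem S → s ∈ ψ.sem S) := by
  change ¬ (s ∈ φ.sem S ∧ ¬ s ∈ ψ.sem S) ↔ _
  tauto

theorem mem_sem_iff : s ∈ (φ.iff ψ).sem S ↔ (s ∈ φ.sem S ↔ s ∈ ψ.sem S) := by
  change s ∈ (φ.imp ψ).sem S ∧ s ∈ (ψ.imp φ).sem S ↔ _
  rw [mem_sem_imp, mem_sem_imp]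
  exact iff_def.symm

theorem mem_sem_conj {L : List (Sentence AtSen Agents Sig)} :
    s ∈ (conj L).sem S ↔ ∀ χ ∈ L, s ∈ χ.sem S := by
  induction L with
  | nil => exact ⟨fun _ => by simp, fun _ => trivial⟩
  | cons χ L ih =>
    change s ∈ χ.sem S ∧ s ∈ (conj L).sem S ↔ _
    rw [ih, List.forall_mem_cons]

theorem mem_sem_after_basic {i : Fin Sig.n} {ψ : Fin Sig.n → Sentence AtSen Agents Sig} :
    s ∈ (after (.basic i ψ) φ).sem S ↔
      ∀ h : s ∈ (ψ (Sig.enum.symm (Sig.enum i))).sem S,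
        (⟨(s, Sig.enum i), h⟩ :
          (updateProduct S (Program.basic i ψ).sem.toActionModel).State) ∈
          φ.sem (updateProduct S (Program.basic i ψ).sem.toActionModel) := by
  refine ProgramModel.mem_update_box_iff.trans ⟨fun h => h _ rfl, ?_⟩
  rintro h _ rfl hs
  exact h hs

theorem forall_mem_actionKnowledgeConj {i : Fin Sig.n} {ψ : Fin Sig.n → Sentence AtSen Agents Sig}
    {A : Agents} {P : Sentence AtSen Agents Sig → Prop} :
    (∀ χ ∈ ((List.finRange Sig.n).filter
      (fun j => @decide (Sig.arrow A (Sig.enum i) (Sig.enum j)) (Classical.propDecidable _))).map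
        (fun j => box A (after (.basic j ψ) φ)), P χ) ↔
      ∀ j, Sig.arrow A (Sig.enum i) (Sig.enum j) → P (box A (after (.basic j ψ) φ)) := by
  simp

end Sentence

open Sentence in
theorem Provable.sound {φ : Sentence AtSen Agents Sig} (h : Provable φ) :
    ∀ (S : StateModel AtSen Agents) (s : S.State), s ∈ φ.sem S := by
  induction h with
  | sentential φ h =>
    intro S s
    exact h (fun χ => s ∈ χ.sem S) trivial (fun _ => Iff.rfl) (fun _ _ => Iff.rfl)
  | after_normality π φ ψ =>
    intro S s
    simp only [mem_sem_imp]
    intro h₁ h₂ t ht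
    exact mem_sem_imp.1 (h₁ t ht) (h₂ t ht)
  | box_normality A φ ψ =>
    intro S s
    simp only [mem_sem_imp]
    intro h₁ h₂ t ht
    exact mem_sem_imp.1 (h₁ t ht) (h₂ t ht)
  | atomic_permanence i ψ p =>
    intro S s
    rw [mem_sem_iff, mem_sem_after_basic, mem_sem_imp]
    have e : Sig.enum.symm (Sig.enum i) = i := Equiv.symm_apply_apply _ _
    exact ⟨fun h hs => h (e.symm ▸ hs), fun h hs => h (e ▸ hs)⟩
  | partial_functionality i ψ χ =>
    intro S s
    rw [mem_sem_iff, mem_sem_after_basic, mem_sem_imp]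
    change _ ↔ (_ → ¬ s ∈ (after (.basic i ψ) χ).sem S)
    rw [mem_sem_after_basic]
    have e : Sig.enum.symm (Sig.enum i) = i := Equiv.symm_apply_apply _ _
    constructor
    · intro h₁ hs h₂
      rw [← e] at hs
      exact h₁ hs (h₂ hs)
    · intro h₁ hs hχ
      exact h₁ (e ▸ hs) (fun _ => hχ)
  | action_knowledge i ψ A φ =>
    intro S s
    have e : ∀ j, Sig.enum.symm (Sig.enum j) = j := Equiv.symm_apply_apply _
    rw [mem_sem_iff, mem_sem_after_basic, mem_sem_imp]
    unfold actionKnowledgeConj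
    rw [mem_sem_conj, forall_mem_actionKnowledgeConj]
    constructor
    · intro h hs j hij t hst
      rw [mem_sem_after_basic]
      intro ht
      rw [← e i] at hs
      exact h hs ⟨(t, Sig.enum j), ht⟩ ⟨hst, hij⟩
    · rintro h hs ⟨⟨t, a⟩, ht⟩ ⟨hst, hia⟩
      obtain ⟨j, rfl⟩ := Sig.enum.surjective a
      exact mem_sem_after_basic.1 (h (e i ▸ hs) j hia t hst) ht
  | skip_axiom φ =>
    intro S s
    exact mem_sem_iff.2 (ProgramModel.mem_skip_box_iff φ.sem_isInvariant)
  | crash_axiom => exact fun S s t ht => ht.2.elim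
  | composition π ρ φ =>
    intro S s
    exact mem_sem_iff.2 (ProgramModel.mem_comp_box_iff φ.sem_isInvariant _ _).symm
  | choice π ρ φ =>
    intro S s
    exact mem_sem_iff.2 (ProgramModel.mem_union_box_iff φ.sem_isInvariant _ _)
  | modus_ponens φ ψ _ _ h₁ h₂ => exact fun S s => mem_sem_imp.1 (h₂ S s) (h₁ S s)
  | after_necessitation π ψ _ h => exact fun S s t _ => h _ t
  | box_necessitation A φ _ h => exact fun S s t _ => h _ t

theorem ProvableFrom.entails {T : Set (Sentence AtSen Agents Sig)} {φ : Sentence AtSen Agents Sig}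
    (h : ProvableFrom T φ) : Entails T φ := by
  obtain ⟨L, hL, hφ⟩ := h
  intro S s hs
  exact Sentence.mem_sem_imp.1 (hφ.sound S s) (Sentence.mem_sem_conj.2 fun χ hχ => hs χ (hL χ hχ))

end Soundness

/-! ### Propositional reasoning -/

section Valuation

variable {AtSen Agents : Type u} {Sig : ActionSignature Agents}

/-- An assignment of truth values that respects the connectives `true`, `¬`, `∧`. -/
structure IsValuation (v : Sentence AtSen Agents Sig → Prop) : Prop where
  tr : v .tr
  neg : ∀ χ, v (.neg χ) ↔ ¬ v χ
  and : ∀ χ θ, v (.and χ θ) ↔ v χ ∧ v θ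

namespace IsValuation

variable {v : Sentence AtSen Agents Sig → Prop}

theorem imp (hv : IsValuation v) (φ ψ : Sentence AtSen Agents Sig) :
    v (φ.imp ψ) ↔ (v φ → v ψ) := by
  rw [Sentence.imp, hv.neg, hv.and, hv.neg]
  tauto

theorem iff (hv : IsValuation v) (φ ψ : Sentence AtSen Agents Sig) :
    v (φ.iff ψ) ↔ (v φ ↔ v ψ) := by
  rw [Sentence.iff, hv.and, hv.imp, hv.imp]
  exact iff_def.symm

theorem fls (hv : IsValuation v) : ¬ v .fls := by
  rw [Sentence.fls, hv.neg]
  exact not_not.2 hv.tr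

theorem conj (hv : IsValuation v) (L : List (Sentence AtSen Agents Sig)) :
    v (.conj L) ↔ ∀ χ ∈ L, v χ := by
  induction L with
  | nil => exact ⟨fun _ => by simp, fun _ => hv.tr⟩
  | cons χ L ih => rw [Sentence.conj, hv.and, ih, List.forall_mem_cons]

end IsValuation

namespace Provable

variable {φ ψ χ θ : Sentence AtSen Agents Sig}

theorem of_valuation (h : ∀ v, IsValuation v → v φ) : Provable φ :=
  .sentential φ fun v h₁ h₂ h₃ => h v ⟨h₁, h₂, h₃⟩

/-- Theorems are closed under propositional consequence. -/
theorem of_consequence (hφ : Provable φ) (h : ∀ v, IsValuation v → v φ → v ψ) : Provable ψ :=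
  .modus_ponens φ ψ hφ (of_valuation fun v hv => (hv.imp _ _).2 (h v hv))

theorem and_intro (hφ : Provable φ) (hψ : Provable ψ) : Provable (φ.and ψ) :=
  .modus_ponens ψ _ hψ <| hφ.of_consequence fun _ hv h => (hv.imp _ _).2 fun h' =>
    (hv.and _ _).2 ⟨h, h'⟩

theorem of_consequence₂ (hφ : Provable φ) (hψ : Provable ψ)
    (h : ∀ v, IsValuation v → v φ → v ψ → v χ) : Provable χ :=
  (hφ.and_intro hψ).of_consequence fun v hv hc =>
    h v hv ((hv.and _ _).1 hc).1 ((hv.and _ _).1 hc).2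

theorem iff_trans (h₁ : Provable (φ.iff ψ)) (h₂ : Provable (ψ.iff χ)) : Provable (φ.iff χ) :=
  h₁.of_consequence₂ h₂ fun v hv => by
    simp only [hv.iff]
    exact Iff.trans

theorem iff_symm (h : Provable (φ.iff ψ)) : Provable (ψ.iff φ) :=
  h.of_consequence fun v hv => by
    simp only [hv.iff]
    exact Iff.symm

theorem iff_refl (φ : Sentence AtSen Agents Sig) : Provable (φ.iff φ) :=
  of_valuation fun _ hv => (hv.iff _ _).2 Iff.rfl

theorem neg_congr (h : Provable (φ.iff ψ)) : Provable (φ.neg.iff ψ.neg) :=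
  h.of_consequence fun v hv => by
    simp only [hv.iff, hv.neg]
    exact not_congr

theorem and_congr (h₁ : Provable (φ.iff ψ)) (h₂ : Provable (χ.iff θ)) :
    Provable ((φ.and χ).iff (ψ.and θ)) :=
  h₁.of_consequence₂ h₂ fun v hv => by
    simp only [hv.iff, hv.and]
    exact _root_.and_congr

theorem iff_mp (h : Provable (φ.iff ψ)) : Provable (φ.imp ψ) :=
  h.of_consequence fun _ hv hc => ((hv.and _ _).1 hc).1

theorem iff_mpr (h : Provable (φ.iff ψ)) : Provable (ψ.imp φ) :=
  h.of_consequence fun _ hv hc => ((hv.and _ _).1 hc).2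

theorem box_mono (A : Agents) (h : Provable (φ.imp ψ)) :
    Provable ((Sentence.box A φ).imp (.box A ψ)) :=
  .modus_ponens _ _ (.box_necessitation A _ h) (.box_normality A φ ψ)

theorem after_mono (π : Program AtSen Agents Sig) (h : Provable (φ.imp ψ)) :
    Provable ((Sentence.after π φ).imp (.after π ψ)) :=
  .modus_ponens _ _ (.after_necessitation π _ h) (.after_normality π φ ψ)

theorem box_congr (A : Agents) (h : Provable (φ.iff ψ)) :
    Provable ((Sentence.box A φ).iff (.box A ψ)) :=
  and_intro (box_mono A h.iff_mp) (box_mono A h.iff_mpr)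

theorem after_congr (π : Program AtSen Agents Sig) (h : Provable (φ.iff ψ)) :
    Provable ((Sentence.after π φ).iff (.after π ψ)) :=
  and_intro (after_mono π h.iff_mp) (after_mono π h.iff_mpr)

theorem after_and (π : Program AtSen Agents Sig) (φ ψ : Sentence AtSen Agents Sig) :
    Provable ((Sentence.after π (φ.and ψ)).iff ((Sentence.after π φ).and (.after π ψ))) := by
  have h₁ : Provable ((Sentence.after π (φ.and ψ)).imp (.after π φ)) :=
    after_mono π (of_valuation fun v hv => by simp only [hv.imp, hv.and]; exact And.left)
  have h₂ : Provable ((Sentence.after π (φ.and ψ)).imp (.after π ψ)) :=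
    after_mono π (of_valuation fun v hv => by simp only [hv.imp, hv.and]; exact And.right)
  have h₃ : Provable ((Sentence.after π φ).imp (.after π (ψ.imp (φ.and ψ)))) :=
    after_mono π (of_valuation fun v hv => by simp only [hv.imp, hv.and]; exact And.intro)
  refine (h₁.and_intro h₂).of_consequence₂ (h₃.and_intro (.after_normality π ψ (φ.and ψ)))
    fun v hv => ?_
  simp only [hv.imp, hv.and, hv.iff]
  tauto

theorem box_and_imp (A : Agents) (φ ψ : Sentence AtSen Agents Sig) :
    Provable (((Sentence.box A φ).and (.box A ψ)).imp (.box A (φ.and ψ))) := by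
  have h : Provable ((Sentence.box A φ).imp (.box A (ψ.imp (φ.and ψ)))) :=
    box_mono A (of_valuation fun v hv => by simp only [hv.imp, hv.and]; exact And.intro)
  refine h.of_consequence₂ (.box_normality A ψ (φ.and ψ)) fun v hv => ?_
  simp only [hv.imp, hv.and]
  tauto

end Provable

end Valuation

/-! ### Reduction to the modal fragment -/

section Reduction

variable {AtSen Agents : Type u} {Sig : ActionSignature Agents}

/-- The sentences without program modalities. -/
inductive Sentence.IsModal : Sentence AtSen Agents Sig → Prop
  | tr : IsModal .tr
  | atom (p : AtSen) : IsModal (.atom p)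
  | neg {φ : Sentence AtSen Agents Sig} : IsModal φ → IsModal φ.neg
  | and {φ ψ : Sentence AtSen Agents Sig} : IsModal φ → IsModal ψ → IsModal (φ.and ψ)
  | box (A : Agents) {φ : Sentence AtSen Agents Sig} : IsModal φ → IsModal (.box A φ)

/-- `φ` is provably equivalent to a sentence without program modalities. -/
def Sentence.IsReducible (φ : Sentence AtSen Agents Sig) : Prop :=
  ∃ χ : Sentence AtSen Agents Sig, χ.IsModal ∧ Provable (φ.iff χ)

/-- `[π]χ` reduces to the modal fragment for every `χ` in the modal fragment. -/
def Program.IsReducible (π : Program AtSen Agents Sig) : Prop :=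
  ∀ χ : Sentence AtSen Agents Sig, χ.IsModal → (Sentence.after π χ).IsReducible

namespace Sentence.IsReducible

variable {φ ψ : Sentence AtSen Agents Sig}

theorem of_isModal (h : φ.IsModal) : φ.IsReducible := ⟨φ, h, .iff_refl φ⟩

theorem of_iff (h : Provable (φ.iff ψ)) : ψ.IsReducible → φ.IsReducible :=
  fun ⟨χ, hχ, h'⟩ => ⟨χ, hχ, h.iff_trans h'⟩

theorem neg : φ.IsReducible → φ.neg.IsReducible :=
  fun ⟨_, hχ, h⟩ => ⟨_, hχ.neg, h.neg_congr⟩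

theorem and : φ.IsReducible → ψ.IsReducible → (φ.and ψ).IsReducible :=
  fun ⟨_, h₁, h₁'⟩ ⟨_, h₂, h₂'⟩ => ⟨_, h₁.and h₂, h₁'.and_congr h₂'⟩

theorem imp (hφ : φ.IsReducible) (hψ : ψ.IsReducible) : (φ.imp ψ).IsReducible :=
  (hφ.and hψ.neg).neg

theorem box (A : Agents) : φ.IsReducible → (Sentence.box A φ).IsReducible :=
  fun ⟨_, hχ, h⟩ => ⟨_, hχ.box A, h.box_congr A⟩

theorem after {π : Program AtSen Agents Sig} (hπ : π.IsReducible) :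
    φ.IsReducible → (Sentence.after π φ).IsReducible :=
  fun ⟨χ, hχ, h⟩ => of_iff (h.after_congr π) (hπ χ hχ)

theorem conj {L : List (Sentence AtSen Agents Sig)} (h : ∀ χ ∈ L, χ.IsReducible) :
    (Sentence.conj L).IsReducible := by
  induction L with
  | nil => exact of_isModal .tr
  | cons χ L ih =>
    rw [List.forall_mem_cons] at h
    exact h.1.and (ih h.2)

end Sentence.IsReducible

theorem Program.isReducible_basic {ψ : Fin Sig.n → Sentence AtSen Agents Sig}
    (hψ : ∀ j, (ψ j).IsReducible) (i : Fin Sig.n) : (Program.basic i ψ).IsReducible := by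
  intro χ hχ
  induction hχ generalizing i with
  | tr =>
    refine .of_iff (ψ := .tr) ?_ (.of_isModal .tr)
    refine (Provable.after_necessitation (.basic i ψ) .tr
      (.of_valuation fun _ hv => hv.tr)).of_consequence fun v hv h => ?_
    exact (hv.iff _ _).2 (iff_of_true h hv.tr)
  | atom p => exact .of_iff (.atomic_permanence i ψ p) ((hψ i).imp (.of_isModal (.atom p)))
  | neg _ ih => exact .of_iff (.partial_functionality i ψ _) ((hψ i).imp (ih i).neg)
  | and _ _ ih₁ ih₂ => exact .of_iff (.after_and _ _ _) ((ih₁ i).and (ih₂ i))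
  | box A _ ih =>
    refine .of_iff (.action_knowledge i ψ A _) ((hψ i).imp (.conj ?_))
    rw [Sentence.forall_mem_actionKnowledgeConj]
    exact fun j _ => (ih j).box A

mutual

theorem Sentence.isReducible : (φ : Sentence AtSen Agents Sig) → φ.IsReducible
  | .tr => .of_isModal .tr
  | .atom p => .of_isModal (.atom p)
  | .neg φ => (Sentence.isReducible φ).neg
  | .and φ ψ => (Sentence.isReducible φ).and (Sentence.isReducible ψ)
  | .box A φ => (Sentence.isReducible φ).box A
  | .after π φ => .after (Program.isReducible π) (Sentence.isReducible φ)

theorem Program.isReducible : (π : Program AtSen Agents Sig) → π.IsReducible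
  | .skip => fun _ hχ => .of_iff (Provable.skip_axiom _) (.of_isModal hχ)
  | .crash => fun χ _ => by
    refine .of_iff (ψ := .tr) ?_ (.of_isModal .tr)
    have h : Provable ((Sentence.after .crash .fls).imp (.after .crash χ)) :=
      Provable.after_mono _ (.of_valuation fun v hv => (hv.imp _ _).2 fun h => (hv.fls h).elim)
    refine (Provable.modus_ponens _ _ Provable.crash_axiom h).of_consequence fun v hv h => ?_
    exact (hv.iff _ _).2 (iff_of_true h hv.tr)
  | .basic i ψ => Program.isReducible_basic (fun j => Sentence.isReducible (ψ j)) i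
  | .union π ρ => fun χ hχ =>
    .of_iff (.choice π ρ χ) ((Program.isReducible π χ hχ).and (Program.isReducible ρ χ hχ))
  | .comp π ρ => fun χ hχ =>
    .of_iff (Provable.composition π ρ χ).iff_symm
      (.after (Program.isReducible π) (Program.isReducible ρ χ hχ))

end

end Reduction

/-! ### The canonical model and completeness -/

section Completeness

variable {AtSen Agents : Type u} {Sig : ActionSignature Agents}

/-- A complete theory: a set of sentences that contains all theorems and whose membership
predicate respects the connectives. -/
structure IsCompleteTheory (Δ : Set (Sentence AtSen Agents Sig)) : Prop where
  isValuation : IsValuation (· ∈ Δ)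
  mem_of_provable : ∀ χ, Provable χ → χ ∈ Δ

namespace ProvableFrom

variable {T : Set (Sentence AtSen Agents Sig)} {φ ψ χ : Sentence AtSen Agents Sig}

theorem of_mem (h : φ ∈ T) : ProvableFrom T φ :=
  ⟨[φ], by simpa using h, .of_valuation fun v hv => by
    rw [hv.imp, hv.conj]
    exact fun h => h φ (by simp)⟩

theorem of_provable (h : Provable φ) : ProvableFrom T φ :=
  ⟨[], by simp, h.of_consequence fun v hv h => (hv.imp _ _).2 fun _ => h⟩

theorem of_consequence₂ (h₁ : ProvableFrom T φ) (h₂ : ProvableFrom T ψ)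
    (h : ∀ v, IsValuation v → v φ → v ψ → v χ) : ProvableFrom T χ := by
  obtain ⟨L₁, hL₁, h₁⟩ := h₁
  obtain ⟨L₂, hL₂, h₂⟩ := h₂
  refine ⟨L₁ ++ L₂, fun θ hθ => (List.mem_append.1 hθ).elim (hL₁ θ) (hL₂ θ),
    h₁.of_consequence₂ h₂ fun v hv => ?_⟩
  simp only [hv.imp, hv.conj]
  exact fun h₁ h₂ hL => h v hv (h₁ fun θ hθ => hL θ (List.mem_append_left _ hθ))
    (h₂ fun θ hθ => hL θ (List.mem_append_right _ hθ))

theorem of_consequence (h₁ : ProvableFrom T φ) (h : ∀ v, IsValuation v → v φ → v χ) :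
    ProvableFrom T χ :=
  h₁.of_consequence₂ h₁ fun v hv h' _ => h v hv h'

theorem deduction (h : ProvableFrom (insert χ T) φ) : ProvableFrom T (χ.imp φ) := by
  classical
  obtain ⟨L, hL, h⟩ := h
  refine ⟨L.filter (· ≠ χ), fun θ hθ => ?_, h.of_consequence fun v hv => ?_⟩
  · simp only [List.mem_filter, decide_eq_true_eq] at hθ
    exact (hL θ hθ.1).resolve_left hθ.2
  · simp only [hv.imp, hv.conj, List.mem_filter, decide_eq_true_eq]
    intro h hL' hχ
    refine h fun θ hθ => ?_
    by_cases e : θ = χ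
    · exact e ▸ hχ
    · exact hL' θ ⟨hθ, e⟩

theorem exists_of_sUnion {c : Set (Set (Sentence AtSen Agents Sig))}
    (hc : IsChain (· ⊆ ·) c) (hne : c.Nonempty) (h : ProvableFrom (⋃₀ c) φ) :
    ∃ T ∈ c, ProvableFrom T φ := by
  obtain ⟨L, hL, h⟩ := h
  suffices ∃ T ∈ c, ∀ χ ∈ L, χ ∈ T from
    this.imp fun T hT => ⟨hT.1, L, hT.2, h⟩
  clear h
  induction L with
  | nil => exact hne.imp fun T hT => ⟨hT, by simp⟩
  | cons χ L ih =>
    rw [List.forall_mem_cons] at hL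
    obtain ⟨T, hT, hLT⟩ := ih hL.2
    obtain ⟨T', hT', hχ⟩ := hL.1
    rcases hc.total hT hT' with hs | hs
    · exact ⟨T', hT', List.forall_mem_cons.2 ⟨hχ, fun θ hθ => hs (hLT θ hθ)⟩⟩
    · exact ⟨T, hT, List.forall_mem_cons.2 ⟨hs hχ, hLT⟩⟩

theorem box {A : Agents} (hT : IsCompleteTheory T)
    (h : ProvableFrom {χ | Sentence.box A χ ∈ T} φ) : Sentence.box A φ ∈ T := by
  obtain ⟨L, hL, h⟩ := h
  have mp : ∀ {χ θ : Sentence AtSen Agents Sig}, Provable (χ.imp θ) → χ ∈ T → θ ∈ T :=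
    fun h => (hT.isValuation.imp _ _).1 (hT.mem_of_provable _ h)
  refine mp (h.box_mono A) ?_
  clear h
  induction L with
  | nil =>
    exact hT.mem_of_provable _ (.box_necessitation A _ (.of_valuation fun _ hv => hv.tr))
  | cons χ L ih =>
    rw [List.forall_mem_cons] at hL
    exact mp (.box_and_imp A _ _) ((hT.isValuation.and _ _).2 ⟨hL.1, ih hL.2⟩)

end ProvableFrom

/-- Lindenbaum's lemma. -/
theorem exists_isCompleteTheory {T : Set (Sentence AtSen Agents Sig)}
    {φ : Sentence AtSen Agents Sig} (h : ¬ ProvableFrom T φ) :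
    ∃ Δ, IsCompleteTheory Δ ∧ T ⊆ Δ ∧ φ ∉ Δ := by
  obtain ⟨Δ, hTΔ, hmax⟩ := zorn_subset_nonempty {Δ | ¬ ProvableFrom Δ φ}
    (fun c hc hch hne => ⟨⋃₀ c, fun hp =>
      let ⟨_, hT', hp'⟩ := hp.exists_of_sUnion hch hne
      hc hT' hp', fun _ => Set.subset_sUnion_of_mem⟩) T h
  have hΔ : ¬ ProvableFrom Δ φ := hmax.prop
  have himp : ∀ {χ}, χ ∉ Δ → ProvableFrom Δ (χ.imp φ) := fun {χ} hχ => by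
    by_contra hc
    exact hχ (hmax.le_of_ge (y := insert χ Δ) (fun hp => hc hp.deduction)
      (Set.subset_insert χ Δ) (Set.mem_insert χ Δ))
  have hclosed : ∀ {χ}, ProvableFrom Δ χ → χ ∈ Δ := fun {χ} hχ => by
    by_contra hc
    exact hΔ (hχ.of_consequence₂ (himp hc) fun v hv h₁ h₂ => (hv.imp _ _).1 h₂ h₁)
  refine ⟨Δ, ⟨⟨?_, fun χ => ⟨fun h₁ h₂ => ?_, fun h₁ => ?_⟩, fun χ θ => ⟨fun h₁ => ⟨?_, ?_⟩,
    fun h₁ => ?_⟩⟩, fun χ hχ => hclosed (.of_provable hχ)⟩, hTΔ, fun hφ => hΔ (.of_mem hφ)⟩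
  · exact hclosed (.of_provable (.of_valuation fun _ hv => hv.tr))
  · exact hΔ ((ProvableFrom.of_mem h₁).of_consequence₂ (.of_mem h₂)
      fun v hv h₁ h₂ => ((hv.neg _).1 h₁ h₂).elim)
  · by_contra h₂
    refine hΔ ((himp h₁).of_consequence₂ (himp h₂) fun v hv => ?_)
    simp only [hv.imp, hv.neg]
    tauto
  · exact hclosed ((ProvableFrom.of_mem h₁).of_consequence fun v hv h => ((hv.and _ _).1 h).1)
  · exact hclosed ((ProvableFrom.of_mem h₁).of_consequence fun v hv h => ((hv.and _ _).1 h).2)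
  · exact hclosed ((ProvableFrom.of_mem h₁.1).of_consequence₂ (.of_mem h₁.2)
      fun v hv h₁ h₂ => (hv.and _ _).2 ⟨h₁, h₂⟩)

/-- The canonical model: its states are the complete theories. -/
def canonicalModel (AtSen : Type u) {Agents : Type u} (Sig : ActionSignature Agents) :
    StateModel AtSen Agents where
  State := {Δ : Set (Sentence AtSen Agents Sig) // IsCompleteTheory Δ}
  arrow A Δ Δ' := ∀ χ, Sentence.box A χ ∈ Δ.1 → χ ∈ Δ'.1
  val p := {Δ | Sentence.atom p ∈ Δ.1}

theorem Sentence.IsModal.mem_sem_canonicalModel {φ : Sentence AtSen Agents Sig} (hφ : φ.IsModal)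
    (Δ : (canonicalModel AtSen Sig).State) : Δ ∈ φ.sem (canonicalModel AtSen Sig) ↔ φ ∈ Δ.1 := by
  induction hφ generalizing Δ with
  | tr => exact iff_of_true trivial Δ.2.isValuation.tr
  | atom p => exact Iff.rfl
  | neg _ ih => exact (not_congr (ih Δ)).trans (Δ.2.isValuation.neg _).symm
  | and _ _ ih₁ ih₂ => exact (and_congr (ih₁ Δ) (ih₂ Δ)).trans (Δ.2.isValuation.and _ _).symm
  | @box A φ _ ih =>
    constructor
    · intro h
      by_contra hc
      obtain ⟨Δ', hΔ', hsub, hφ⟩ :=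
        exists_isCompleteTheory fun h' : ProvableFrom {χ | Sentence.box A χ ∈ Δ.1} φ =>
          hc (h'.box Δ.2)
      exact hφ ((ih ⟨Δ', hΔ'⟩).1 (h ⟨Δ', hΔ'⟩ fun χ hχ => hsub hχ))
    · intro h Δ' hΔ'
      exact (ih Δ').2 (hΔ' φ h)

/-- The truth lemma. -/
theorem Sentence.mem_sem_canonicalModel (φ : Sentence AtSen Agents Sig)
    (Δ : (canonicalModel AtSen Sig).State) : Δ ∈ φ.sem (canonicalModel AtSen Sig) ↔ φ ∈ Δ.1 := by
  obtain ⟨χ, hχ, h⟩ := φ.isReducible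
  exact (Sentence.mem_sem_iff.1 (h.sound _ Δ)).trans ((hχ.mem_sem_canonicalModel Δ).trans
    ((Δ.2.isValuation.iff _ _).1 (Δ.2.mem_of_provable _ h)).symm)

theorem Entails.provableFrom {T : Set (Sentence AtSen Agents Sig)} {φ : Sentence AtSen Agents Sig}
    (h : Entails T φ) : ProvableFrom T φ := by
  by_contra hc
  obtain ⟨Δ, hΔ, hT, hφ⟩ := exists_isCompleteTheory hc
  exact hφ ((φ.mem_sem_canonicalModel ⟨Δ, hΔ⟩).1
    (h (canonicalModel AtSen Sig) ⟨Δ, hΔ⟩ fun χ hχ => (χ.mem_sem_canonicalModel ⟨Δ, hΔ⟩).2 (hT hχ)))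

end Completeness

end EpistemicActions

theorem mainTheorem2 {AtSen Agents : Type u}
    (Sig : EpistemicActions.ActionSignature Agents)
    (T : Set (EpistemicActions.Sentence AtSen Agents Sig))
    (φ : EpistemicActions.Sentence AtSen Agents Sig) :
    EpistemicActions.ProvableFrom T φ ↔ EpistemicActions.Entails T φ :=
  ⟨EpistemicActions.ProvableFrom.entails, EpistemicActions.Entails.provableFrom⟩
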